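/- Let $\mathbb D=\{z\in\mathbb C:|z|<1\}$ and, for a polynomial $P\in\mathbb C[z]$, $P\ne 0$, put $$\|P\|_0:=\exp\left(\frac1\pi\iint_{\mathbb D}\log|P(z)|\,dA(z)\right),$$ where $dA$ is Lebesgue area measure. Let $(P_n)_{n\ge1}$ be a sequence of polynomials with integer coefficients such that $\deg P_n=n$ and $P_n$ has no multiple zeros in $\mathbb C$, for every $n\ge1$. Let $z_{1,n},\dots,z_{n,n}\in\mathbb C$ be the zeros of $P_n$, and let $$\nu_n:=\frac1n\sum_{j=1}^n\delta_{z_{j,n}}$$ be its normalized zero counting measure, $\delta_z$ being the unit point mass at $z$. If $$\lim_{n\to\infty}\|P_n\|_0^{1/n}=1,$$ then $\nu_n$ converges in the weak* topology, as $n\to\infty$, to the normalized arclength measure $d\theta/(2\pi)$ on the unit circle; that is, for every bounded continuous function $f:\mathbb C\to\mathbb R$, $$\lim_{n\to\infty}\frac1n\sum_{j=1}^n f(z_{j,n})=\frac1{2\pi}\int_0^{2\pi}f(e^{i\theta})\,d\theta.$$ -/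

import Mathlib

open MeasureTheory Filter Topology Polynomial
open scoped ENNReal NNReal

/-- The areal Mahler measure (the Bergman space `A⁰` norm)
`‖P‖₀ = exp ((1/π) ∬_𝔻 log |P(z)| dA)`, with `dA` Lebesgue measure and `𝔻` the open unit disk.
For `P ≠ 0` the integrand is integrable on `𝔻`. -/
noncomputable def arealMahler (P : ℂ[X]) : ℝ :=
  Real.exp (1 / Real.pi * ∫ z in Metric.ball (0 : ℂ) 1, Real.log ‖P.eval z‖)

/-- The normalized zero counting measure `(1/n) ∑ⱼ δ_{zⱼ}` of a complex polynomial of degree `n`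
with zeros `z₁, …, zₙ` listed with multiplicity (the zero measure for a constant polynomial). -/
noncomputable def zeroCountingMeasure (P : ℂ[X]) : Measure ℂ :=
  (P.natDegree : ℝ≥0)⁻¹ • (P.roots.map fun z => Measure.dirac z).sum

/-- The normalized arclength `dθ/(2π)` on the unit circle, as a Borel measure on `ℂ`. -/
noncomputable def normalizedArclength : Measure ℂ :=
  Measure.map (fun θ : ℝ => Complex.exp (θ * Complex.I))
    ((ENNReal.ofReal (2 * Real.pi))⁻¹ • volume.restrict (Set.Ioc 0 (2 * Real.pi)))

instance zeroCountingMeasure_isFiniteMeasure (P : ℂ[X]) :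
    IsFiniteMeasure (zeroCountingMeasure P) := by
  have h : ∀ s : Multiset ℂ,
      IsFiniteMeasure (s.map fun z => (Measure.dirac z : Measure ℂ)).sum := by
    intro s
    induction s using Multiset.induction_on with
    | empty => rw [Multiset.map_zero, Multiset.sum_zero]; infer_instance
    | cons a s ih => rw [Multiset.map_cons, Multiset.sum_cons]; infer_instance
  have := h P.roots
  unfold zeroCountingMeasure
  infer_instance

instance normalizedArclength_isProbabilityMeasure :
    IsProbabilityMeasure normalizedArclength := by
  unfold normalizedArclength
  have h : IsProbabilityMeasure ((ENNReal.ofReal (2 * Real.pi))⁻¹ •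
      (volume : Measure ℝ).restrict (Set.Ioc 0 (2 * Real.pi))) := by
    constructor
    have h0 : ENNReal.ofReal (2 * Real.pi) ≠ 0 := by
      simpa using Real.pi_pos
    simp only [Measure.smul_apply, smul_eq_mul, Measure.restrict_apply_univ, Real.volume_Ioc,
      sub_zero]
    exact ENNReal.inv_mul_cancel h0 ENNReal.ofReal_ne_top
  exact Measure.isProbabilityMeasure_map (by fun_prop)

/-- The zero counting measure as a point of the space of finite Borel measures on `ℂ`, which
carries the topology of weak convergence (tested on bounded continuous functions). -/
noncomputable def zeroCountingFiniteMeasure (P : ℂ[X]) : FiniteMeasure ℂ :=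
  ⟨zeroCountingMeasure P, inferInstance⟩

/-- The normalized arclength on the unit circle as a finite Borel measure on `ℂ`. -/
noncomputable def arclengthFiniteMeasure : FiniteMeasure ℂ :=
  ⟨normalizedArclength, inferInstance⟩

/-!
The hypothesis only controls the areal Mahler measure, so the argument passes to the classical
Mahler measure first and then uses the discriminant.

The mean of `log |z - a|` over the unit disk is `log⁺ |a| - max 0 (1 - |a|²) / 2`, by polar
coordinates and the circle averages of `log |z - a|`. Hence (`log_arealMahler`) `log ‖P‖₀` is the
logarithmic Mahler measure of `P` minus half the sum of `1 - |z|²` over the zeros in the disk. The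
lowest nonzero coefficient of `P` is a nonzero integer, so the sum of `log |z|` over the nonzero
zeros is at least `-log |leading coefficient|`. As `log (1/|z|)` exceeds `(1 - |z|²) / 2` by at least
`(1 - |z|²)² / 4` in the disk, `∑ (1 - |z|²)²` is at most `4 log ‖P‖₀ + 3`
(`sum_sq_le_log_arealMahler`). Under the hypothesis and by Cauchy-Schwarz, the mean of `1 - |z|²` over
the zeros in the disk is then `o(1)`, and the logarithmic Mahler measure is `o(n)`.

The zeros being simple, the resultant of `P` and `P'` is a nonzero integer, which bounds
`∑ log |x - y|` over pairs of distinct zeros from below. Reflect the zeros outside the disk into it;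
`|x - y|` is then at most `|1 - a b̄|`, for the reflected points `a` and `b`, times `max 1 |x|` and
`max 1 |y|`. The kernel `-log |1 - r a b̄| = ∑ r^k Re (a b̄)^k / k` is positive definite term by term,
and passing from `r = 1` to `r < 1` costs `log (1/r) / 2` per pair while making the diagonal finite.
So the squared modulus of the mean of `a^k` is small (`normSq_sum_diskReflection_pow_le`): let `n → ∞`
and then `r → 1`. All power moments tend to zero and `|a| → 1` on average, and the equidistribution
follows by density of trigonometric polynomials (`tendsto_average_circleAverage`).
-/

/-! ### The areal Mahler measure in terms of the zeros -/

theorem integrableOn_log_norm_sub_ball (a : ℂ) :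
    IntegrableOn (fun z : ℂ => Real.log ‖z - a‖) (Metric.ball 0 1) := by
  have h0 : IntegrableOn (fun z : ℂ => Real.log ‖z‖) (Metric.ball 0 (1 + ‖a‖)) := by
    rw [integrableOn_fun_norm_addHaar volume (f := Real.log), Complex.finrank_real_complex]
    have hc : Continuous fun y : ℝ => y ^ (2 - 1) • Real.log y := by
      simpa using Real.continuous_mul_log
    exact (hc.continuousOn.integrableOn_compact isCompact_Icc).mono_set Set.Ioo_subset_Icc_self
  have h1 := ((measurePreserving_sub_right (volume : Measure ℂ) a).integrableOn_comp_preimage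
    (MeasurableEquiv.subRight a).measurableEmbedding).2 h0
  refine h1.mono_set fun z hz => ?_
  simp only [Set.mem_preimage, Metric.mem_ball, dist_zero_right] at hz ⊢
  linarith [norm_sub_le z a]

/-- Integration over the unit disk in polar coordinates, the angular integral being written as a
circle average. -/
theorem integral_ball_eq_integral_circleAverage {f : ℂ → ℝ} (hm : Measurable f)
    (hf : IntegrableOn f (Metric.ball 0 1)) :
    ∫ z in Metric.ball 0 1, f z =
      ∫ r in (0 : ℝ)..1, 2 * Real.pi * r * Real.circleAverage f 0 r := by
  set g : ℂ → ℝ := (Metric.ball (0 : ℂ) 1).indicator f with hg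
  have hgm : Measurable g := hm.indicator measurableSet_ball
  have hgi : Integrable g := (integrable_indicator_iff measurableSet_ball).2 hf
  have hsymm : Measurable fun p : ℝ × ℝ => Complex.polarCoord.symm p := by
    simp only [Complex.polarCoord_symm_apply]
    fun_prop
  have hi : IntegrableOn (fun p : ℝ × ℝ => p.1 • g (Complex.polarCoord.symm p))
      (Set.Ioi (0 : ℝ) ×ˢ Set.Ioo (-Real.pi) Real.pi) (volume.prod volume) := by
    refine ⟨(measurable_fst.smul (hgm.comp hsymm)).aestronglyMeasurable, ?_⟩
    have h2 := hgi.hasFiniteIntegral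
    rw [hasFiniteIntegral_iff_enorm] at h2 ⊢
    rw [← Complex.lintegral_comp_polarCoord_symm] at h2
    refine lt_of_le_of_lt (le_of_eq ?_) h2
    refine setLIntegral_congr_fun (measurableSet_Ioi.prod measurableSet_Ioo) fun p hp => ?_
    have hp1 : (0 : ℝ) < p.1 := hp.1
    simp only [smul_eq_mul, enorm_mul, Real.enorm_of_nonneg hp1.le]
  rw [← integral_indicator measurableSet_ball, ← hg, ← Complex.integral_comp_polarCoord_symm]
  change ∫ p in Set.Ioi (0 : ℝ) ×ˢ Set.Ioo (-Real.pi) Real.pi, _ ∂(volume.prod volume) = _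
  rw [setIntegral_prod _ hi, intervalIntegral.integral_of_le zero_le_one,
    ← integral_indicator measurableSet_Ioi, ← integral_indicator measurableSet_Ioc]
  have h1 : ∀ᵐ r : ℝ, r ≠ 1 := by
    simp [ae_iff, measure_singleton]
  refine integral_congr_ae ?_
  filter_upwards [h1] with r hr
  by_cases h0 : 0 < r
  · rw [Set.indicator_of_mem (show r ∈ Set.Ioi (0 : ℝ) from h0)]
    have hmap : ∀ θ : ℝ, Complex.polarCoord.symm (r, θ) = circleMap 0 r θ := fun θ => by
      simp [circleMap, Complex.exp_mul_I]
    by_cases hr1 : r < 1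
    · rw [Set.indicator_of_mem (show r ∈ Set.Ioc (0 : ℝ) 1 from ⟨h0, hr1.le⟩),
        Real.circleAverage_eq_integral_add (-Real.pi), intervalIntegral.integral_comp_add_right
          (fun θ => f (circleMap 0 r θ))]
      have e : (2 * Real.pi + -Real.pi) = Real.pi := by ring
      have hmem : ∀ θ : ℝ, circleMap 0 r θ ∈ Metric.ball (0 : ℂ) 1 := fun θ => by
        simp [abs_of_pos h0, hr1]
      rw [e, zero_add, intervalIntegral.integral_of_le (by linarith [Real.pi_pos]),
        integral_Ioc_eq_integral_Ioo]
      simp only [hmap, hg, Set.indicator_of_mem (hmem _), smul_eq_mul, integral_const_mul]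
      field_simp [Real.pi_pos.ne']
    · have hnm : ∀ θ : ℝ, circleMap 0 r θ ∉ Metric.ball (0 : ℂ) 1 := fun θ => by
        simpa [abs_of_pos h0] using hr1
      rw [Set.indicator_of_notMem (fun h => hr1 (lt_of_le_of_ne h.2 hr))]
      simp [hmap, hg, Set.indicator_of_notMem (hnm _), -Metric.mem_ball]
  · rw [Set.indicator_of_notMem (show r ∉ Set.Ioi (0 : ℝ) from h0),
      Set.indicator_of_notMem (show r ∉ Set.Ioc (0 : ℝ) 1 from fun h => h0 h.1)]

/-- The mean of `log |z - a|` over the unit disk is `log⁺ |a| - max 0 (1 - |a|²) / 2`. -/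
theorem integral_ball_log_norm_sub (a : ℂ) :
    ∫ z in Metric.ball 0 1, Real.log ‖z - a‖ =
      Real.pi * (Real.posLog ‖a‖ - max 0 (1 - ‖a‖ ^ 2) / 2) := by
  rw [integral_ball_eq_integral_circleAverage (by fun_prop) (integrableOn_log_norm_sub_ball a)]
  set t : ℝ := ‖a‖ with ht
  have ht0 : 0 ≤ t := norm_nonneg a
  -- the part `|a| ≤ r` of the radial integrand
  have hout : ∀ r : ℝ, 0 < r → t ≤ r →
      Real.circleAverage (fun z => Real.log ‖z - a‖) 0 r = Real.log r := by
    intro r hr htr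
    rw [circleAverage_log_norm_sub_const_eq_log_radius_add_posLog hr.ne', zero_sub, norm_neg,
      ← ht, (Real.posLog_eq_zero_iff _).2, add_zero]
    rw [abs_of_nonneg (by positivity), inv_mul_le_iff₀ hr]
    simpa using htr
  have hin : ∀ r : ℝ, 0 < r → r ≤ t →
      Real.circleAverage (fun z => Real.log ‖z - a‖) 0 r = Real.log t := by
    intro r hr htr
    rw [circleAverage_log_norm_sub_const_eq_log_radius_add_posLog hr.ne', zero_sub, norm_neg,
      ← ht, Real.posLog_eq_log, Real.log_mul (by positivity) (by linarith), Real.log_inv]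
    · ring
    · rw [abs_of_nonneg (by positivity), le_inv_mul_iff₀ hr]
      simpa using htr
  -- the inner part contributes a constant mean
  have Iin : ∀ s : ℝ, 0 ≤ s → s ≤ t →
      ∫ r in (0 : ℝ)..s, 2 * Real.pi * r *
        Real.circleAverage (fun z => Real.log ‖z - a‖) 0 r = Real.pi * s ^ 2 * Real.log t := by
    intro s hs hst
    have : ∫ r in (0 : ℝ)..s, 2 * Real.pi * r *
        Real.circleAverage (fun z => Real.log ‖z - a‖) 0 r =
        ∫ r in (0 : ℝ)..s, (2 * Real.pi * Real.log t) * r := by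
      refine intervalIntegral.integral_congr_uIoo fun r hr => ?_
      rw [Set.uIoo_of_le hs] at hr
      simp only [hin r hr.1 (hr.2.le.trans hst)]
      ring
    rw [this, intervalIntegral.integral_const_mul, integral_id]
    ring
  by_cases h1 : 1 ≤ t
  · rw [Iin 1 zero_le_one h1, Real.posLog_eq_log (by rwa [abs_of_nonneg ht0]),
      max_eq_left (by nlinarith)]
    ring
  · push Not at h1
    have hpl : Real.posLog t = 0 :=
      (Real.posLog_eq_zero_iff _).2 (by rw [abs_of_nonneg ht0]; exact h1.le)
    have hcont : Continuous fun r : ℝ => 2 * Real.pi * r * Real.log r := by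
      simpa [mul_assoc] using Real.continuous_mul_log.const_mul (2 * Real.pi)
    have congr_out : Set.EqOn (fun r : ℝ => 2 * Real.pi * r *
        Real.circleAverage (fun z => Real.log ‖z - a‖) 0 r)
        (fun r => 2 * Real.pi * r * Real.log r) (Set.Ioc t 1) := fun r hr => by
      simp only [hout r (ht0.trans_lt hr.1) hr.1.le]
    have iout : IntervalIntegrable (fun r : ℝ => 2 * Real.pi * r *
        Real.circleAverage (fun z => Real.log ‖z - a‖) 0 r) volume t 1 := by
      rw [intervalIntegrable_iff_integrableOn_Ioc_of_le h1.le]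
      refine IntegrableOn.congr_fun ?_ congr_out.symm measurableSet_Ioc
      rw [← intervalIntegrable_iff_integrableOn_Ioc_of_le h1.le]
      exact hcont.intervalIntegrable _ _
    have iin : IntervalIntegrable (fun r : ℝ => 2 * Real.pi * r *
        Real.circleAverage (fun z => Real.log ‖z - a‖) 0 r) volume 0 t := by
      rw [intervalIntegrable_iff_integrableOn_Ioc_of_le ht0]
      refine IntegrableOn.congr_fun (f := fun r => 2 * Real.pi * r * Real.log t) ?_
        (fun r hr => ?_) measurableSet_Ioc
      · rw [← intervalIntegrable_iff_integrableOn_Ioc_of_le ht0]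
        exact Continuous.intervalIntegrable (by fun_prop) _ _
      · simp only [hin r hr.1 hr.2]
    have Iout : ∫ r in t..1, 2 * Real.pi * r *
        Real.circleAverage (fun z => Real.log ‖z - a‖) 0 r =
        (Real.pi * (1 * (1 * Real.log 1)) - Real.pi * 1 ^ 2 / 2) -
          (Real.pi * (t * (t * Real.log t)) - Real.pi * t ^ 2 / 2) := by
      have e : ∫ r in t..1, 2 * Real.pi * r *
          Real.circleAverage (fun z => Real.log ‖z - a‖) 0 r =
          ∫ r in t..1, 2 * Real.pi * r * Real.log r := by
        refine intervalIntegral.integral_congr_uIoo fun r hr => ?_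
        rw [Set.uIoo_of_le h1.le] at hr
        exact congr_out ⟨hr.1, hr.2.le⟩
      rw [e]
      have hcF : Continuous fun r : ℝ =>
          Real.pi * (r * (r * Real.log r)) - Real.pi * r ^ 2 / 2 := by
        have := Real.continuous_mul_log
        fun_prop
      refine intervalIntegral.integral_eq_sub_of_hasDerivAt_of_le h1.le
        (f := fun r : ℝ => Real.pi * (r * (r * Real.log r)) - Real.pi * r ^ 2 / 2)
        hcF.continuousOn (fun r hr => ?_) (hcont.intervalIntegrable _ _)
      have hr0 : r ≠ 0 := (ht0.trans_lt hr.1).ne'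
      have hd := ((((hasDerivAt_id r).mul ((hasDerivAt_id r).mul
        (Real.hasDerivAt_log hr0))).const_mul Real.pi).sub
          ((((hasDerivAt_id r).pow 2).const_mul Real.pi).div_const 2))
      refine hd.congr_deriv ?_
      simp only [id]
      field_simp
      simp
      ring
    rw [← intervalIntegral.integral_add_adjacent_intervals iin iout, Iin t ht0 le_rfl, Iout, hpl,
      max_eq_right (by nlinarith), Real.log_one]
    ring

/-- The logarithm of the areal Mahler measure differs from the logarithmic Mahler measure by a sum
over the zeros in the unit disk. -/
theorem log_arealMahler {P : ℂ[X]} (hP : P ≠ 0) :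
    Real.log (arealMahler P) = Real.log ‖P.leadingCoeff‖ +
      (P.roots.map fun z => Real.posLog ‖z‖ - max 0 (1 - ‖z‖ ^ 2) / 2).sum := by
  have hlc : P.leadingCoeff ≠ 0 := leadingCoeff_ne_zero.2 hP
  have key : ∀ s : Multiset ℂ, ∀ c : ℂ, c ≠ 0 →
      IntegrableOn (fun z => Real.log ‖(C c * (s.map fun a => X - C a).prod).eval z‖)
        (Metric.ball 0 1) ∧
      ∫ z in Metric.ball 0 1, Real.log ‖(C c * (s.map fun a => X - C a).prod).eval z‖ =
        Real.pi * (Real.log ‖c‖ +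
          (s.map fun z => Real.posLog ‖z‖ - max 0 (1 - ‖z‖ ^ 2) / 2).sum) := by
    intro s c hc
    induction s using Multiset.induction_on with
    | empty =>
      have hvol : volume.real (Metric.ball (0 : ℂ) 1) = Real.pi := by
        simp [Measure.real, Complex.volume_ball]
      refine ⟨by simp, ?_⟩
      simp [hvol]
    | cons b s ih =>
      set Q : ℂ[X] := C c * (s.map fun a => X - C a).prod with hQ
      have hQ0 : Q ≠ 0 := by
        refine mul_ne_zero (C_ne_zero.2 hc) (Multiset.prod_ne_zero fun h => ?_)
        obtain ⟨x, -, hx⟩ := Multiset.mem_map.1 h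
        exact X_sub_C_ne_zero x hx
      have hae : (fun z : ℂ => Real.log ‖z - b‖ + Real.log ‖Q.eval z‖)
          =ᵐ[volume.restrict (Metric.ball 0 1)]
          fun z => Real.log ‖(C c * (Multiset.map (fun a => X - C a) (b ::ₘ s)).prod).eval z‖ := by
        refine ae_restrict_of_ae ?_
        have hfin : ({b} ∪ {z | Q.eval z = 0} : Set ℂ).Finite :=
          (Set.finite_singleton b).union (by
            simpa [IsRoot] using Polynomial.finite_setOfPred_isRoot hQ0)
        filter_upwards [measure_eq_zero_iff_ae_notMem.1 (hfin.measure_zero volume)] with z hz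
        simp only [Set.mem_union, Set.mem_singleton_iff, Set.mem_ofPred_eq, not_or] at hz
        have e : C c * (Multiset.map (fun a => X - C a) (b ::ₘ s)).prod = (X - C b) * Q := by
          rw [Multiset.map_cons, Multiset.prod_cons, hQ]; ring
        rw [e, eval_mul (p := X - C b), norm_mul, eval_sub, eval_X, eval_C, Real.log_mul]
        · exact norm_ne_zero_iff.2 (sub_ne_zero.2 hz.1)
        · exact norm_ne_zero_iff.2 hz.2
      have hb := integrableOn_log_norm_sub_ball b
      refine ⟨(hb.add ih.1).congr_fun_ae hae, ?_⟩
      rw [← integral_congr_ae hae, integral_add hb ih.1, ih.2, integral_ball_log_norm_sub,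
        Multiset.map_cons, Multiset.sum_cons]
      ring
  have h := (key P.roots P.leadingCoeff hlc).2
  rw [← (IsAlgClosed.splits P).eq_prod_roots] at h
  rw [arealMahler, Real.log_exp, h, ← mul_assoc, one_div, inv_mul_cancel₀ Real.pi_pos.ne', one_mul]

/-! ### Integrality of the lowest coefficient and of the resultant -/

theorem zero_le_log_norm_intCast (k : ℤ) : 0 ≤ Real.log ‖(k : ℂ)‖ := by
  rcases eq_or_ne k 0 with rfl | hk
  · simp
  · refine Real.log_nonneg ?_
    rw [Complex.norm_intCast]
    exact_mod_cast Int.one_le_abs hk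

/-- The lowest nonzero coefficient of an integer polynomial has absolute value at least `1`;
by Vieta it is the product of the leading coefficient and the nonzero roots.
A root at `0` contributes `log 0 = 0` to the sum. -/
theorem zero_le_log_leadingCoeff_add_sum_log_roots {P : ℤ[X]} (hP : P ≠ 0) :
    0 ≤ Real.log ‖(P.map (Int.castRingHom ℂ)).leadingCoeff‖ +
      ((P.map (Int.castRingHom ℂ)).roots.map fun z => Real.log ‖z‖).sum := by
  have hinj : Function.Injective (Int.castRingHom ℂ) := RingHom.injective_int _
  obtain ⟨Q, hQ, hdvd⟩ := exists_eq_pow_rootMultiplicity_mul_and_not_dvd P hP 0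
  set m := P.rootMultiplicity 0
  have hQ0 : Q ≠ 0 := fun h => hP (by rw [hQ, h, mul_zero])
  set q : ℂ[X] := Q.map (Int.castRingHom ℂ) with hq
  have hq0 : q ≠ 0 := (Polynomial.map_ne_zero_iff hinj).2 hQ0
  have hp : P.map (Int.castRingHom ℂ) = X ^ m * q := by
    rw [hQ, Polynomial.map_mul]
    simp [hq]
  have hc : q.coeff 0 ≠ 0 := by
    rw [hq, coeff_map]
    simp only [eq_intCast, ne_eq, Int.cast_eq_zero]
    intro h
    exact hdvd (by rwa [C_0, sub_zero, X_dvd_iff])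
  have hroots : (0 : ℂ) ∉ q.roots := fun h => hc (by
    rw [coeff_zero_eq_eval_zero]; exact (mem_roots'.1 h).2)
  have hviete : ‖q.coeff 0‖ = ‖q.leadingCoeff‖ * (q.roots.map fun z => ‖z‖).prod := by
    rw [(IsAlgClosed.splits q).coeff_zero_eq_leadingCoeff_mul_prod_roots, norm_mul, norm_mul,
      norm_pow, norm_neg, norm_one, one_pow, one_mul]
    congr 1
    exact map_multiset_prod (normHom : ℂ →*₀ ℝ) q.roots
  have hne : (0 : ℝ) ∉ q.roots.map fun z => ‖z‖ := fun h => by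
    obtain ⟨z, hz, hz0⟩ := Multiset.mem_map.1 h
    exact hroots (by rwa [← norm_eq_zero.1 hz0])
  have hlog : Real.log ‖q.coeff 0‖ = Real.log ‖q.leadingCoeff‖ +
      (q.roots.map fun z => Real.log ‖z‖).sum := by
    rw [hviete, Real.log_mul (norm_ne_zero_iff.2 (leadingCoeff_ne_zero.2 hq0))
      (Multiset.prod_ne_zero hne), Real.log_multiset_prod (fun x hx h => hne (h ▸ hx)),
      Multiset.map_map]
    rfl
  rw [hp, leadingCoeff_mul, (monic_X_pow m).leadingCoeff, one_mul,
    roots_mul (mul_ne_zero (pow_ne_zero _ X_ne_zero) hq0), roots_X_pow, Multiset.map_add,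
    Multiset.sum_add, Multiset.map_nsmul, Multiset.sum_nsmul]
  simp only [Multiset.map_singleton, norm_zero, Real.log_zero, Multiset.sum_singleton, smul_zero,
    zero_add]
  rw [← hlog, hq, coeff_map, eq_intCast]
  exact zero_le_log_norm_intCast _

/-- The discriminant bound: the resultant of an integer polynomial with simple zeros and its
derivative is a nonzero integer. -/
theorem zero_le_log_leadingCoeff_add_sum_log_sub {P : ℤ[X]} (hdeg : 1 ≤ P.natDegree)
    (hs : (P.map (Int.castRingHom ℂ)).roots.Nodup) :
    0 ≤ (2 * P.natDegree - 1) * Real.log ‖(P.map (Int.castRingHom ℂ)).leadingCoeff‖ +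
      ∑ x ∈ (P.map (Int.castRingHom ℂ)).roots.toFinset,
        ∑ y ∈ (P.map (Int.castRingHom ℂ)).roots.toFinset.erase x, Real.log ‖x - y‖ := by
  have hinj : Function.Injective (Int.castRingHom ℂ) := RingHom.injective_int _
  set p : ℂ[X] := P.map (Int.castRingHom ℂ) with hp
  have hdp : p.natDegree = P.natDegree := natDegree_map_eq_of_injective hinj P
  have hp0 : p ≠ 0 := ne_zero_of_natDegree_gt (n := 0) (by omega)
  have hlc : ‖p.leadingCoeff‖ ≠ 0 := norm_ne_zero_iff.2 (leadingCoeff_ne_zero.2 hp0)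
  set S := p.roots.toFinset with hS
  have hSval : S.val = p.roots := by rw [hS, Multiset.toFinset_val, hs.dedup]
  have hcard : S.card = P.natDegree := by
    rw [← hdp, (IsAlgClosed.splits p).natDegree_eq_card_roots, ← hSval]; rfl
  have hres := resultant_eq_prod_eval p (derivative p) (p.natDegree - 1) (natDegree_derivative_le p)
    (IsAlgClosed.splits p)
  have hint : resultant p (derivative p) p.natDegree (p.natDegree - 1) =
      ((resultant P (derivative P) p.natDegree (p.natDegree - 1) : ℤ) : ℂ) := by
    rw [hp, derivative_map, resultant_map_map, eq_intCast]
  have hder : ∀ x ∈ S, ‖(derivative p).eval x‖ =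
      ‖p.leadingCoeff‖ * ∏ y ∈ S.erase x, ‖x - y‖ := by
    intro x hx
    have hval : S.val.erase x = (S.erase x).val := (Finset.erase_val S x).symm
    have e : p = C p.leadingCoeff * (p.roots.map fun a => X - C a).prod :=
      (IsAlgClosed.splits p).eq_prod_roots
    have hx' : x ∈ p.roots := by rw [← hSval]; exact hx
    have : (derivative p).eval x = p.leadingCoeff * ∏ y ∈ S.erase x, (x - y) := by
      conv_lhs => rw [e]
      rw [derivative_C_mul, eval_C_mul, eval_multiset_prod_X_sub_C_derivative hx', ← hSval, hval]
      rfl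
    rw [this, norm_mul, norm_prod]
  have hpos : ∀ x, ∀ y ∈ S.erase x, ‖x - y‖ ≠ 0 := fun x y hy =>
    norm_ne_zero_iff.2 (sub_ne_zero.2 (Finset.ne_of_mem_erase hy).symm)
  have hlog : Real.log ‖resultant p (derivative p) p.natDegree (p.natDegree - 1)‖ =
      (2 * P.natDegree - 1) * Real.log ‖p.leadingCoeff‖ +
        ∑ x ∈ S, ∑ y ∈ S.erase x, Real.log ‖x - y‖ := by
    have e1 : (p.roots.map (derivative p).eval).prod = ∏ x ∈ S, (derivative p).eval x := by
      rw [← hSval]; rfl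
    have e2 : ∀ x ∈ S, Real.log ‖(derivative p).eval x‖ =
        Real.log ‖p.leadingCoeff‖ + ∑ y ∈ S.erase x, Real.log ‖x - y‖ := fun x hx => by
      rw [hder x hx, Real.log_mul hlc (Finset.prod_ne_zero_iff.2 (hpos x)),
        Real.log_prod (hpos x)]
    rw [hres, e1, norm_mul, norm_pow, norm_prod, Real.log_mul (pow_ne_zero _ hlc), Real.log_pow,
      Real.log_prod, Finset.sum_congr rfl e2, Finset.sum_add_distrib, Finset.sum_const, hcard,
      hdp, Nat.cast_sub hdeg, nsmul_eq_mul]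
    · push_cast; ring
    · intro x hx
      rw [hder x hx]
      exact mul_ne_zero hlc (Finset.prod_ne_zero_iff.2 (hpos x))
    · refine Finset.prod_ne_zero_iff.2 fun x hx => ?_
      rw [hder x hx]
      exact mul_ne_zero hlc (Finset.prod_ne_zero_iff.2 (hpos x))
  rw [← hlog, hint]
  exact zero_le_log_norm_intCast _

/-! ### Logarithmic energy of the reflected zeros -/

/-- The retraction of the plane to the closed unit disk that fixes the disk and maps a point
outside it to its mirror image `1 / z̄` in the unit circle. -/
noncomputable def diskReflection (z : ℂ) : ℂ := ((max 1 ‖z‖ ^ 2)⁻¹ : ℝ) * z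

theorem norm_diskReflection (z : ℂ) : ‖diskReflection z‖ = (max 1 ‖z‖ ^ 2)⁻¹ * ‖z‖ := by
  rw [diskReflection, norm_mul, Complex.norm_real, Real.norm_of_nonneg (by positivity)]

theorem norm_diskReflection_le_one (z : ℂ) : ‖diskReflection z‖ ≤ 1 := by
  rw [norm_diskReflection, inv_mul_le_iff₀ (by positivity), mul_one]
  nlinarith [le_max_left 1 ‖z‖, le_max_right 1 ‖z‖]

theorem one_sub_norm_diskReflection_le (z : ℂ) :
    1 - ‖diskReflection z‖ ≤ max 0 (1 - ‖z‖ ^ 2) + Real.posLog ‖z‖ := by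
  rw [norm_diskReflection]
  rcases le_or_gt ‖z‖ 1 with h | h
  · rw [max_eq_left h]
    have := Real.posLog_nonneg (x := ‖z‖)
    have := le_max_right 0 (1 - ‖z‖ ^ 2)
    nlinarith [norm_nonneg z]
  · have h0 : 0 < ‖z‖ := by linarith
    rw [max_eq_right h.le, Real.posLog_eq_log (by rw [abs_of_pos h0]; exact h.le)]
    have h1 := Real.one_sub_inv_le_log_of_pos h0
    have h2 := le_max_left 0 (1 - ‖z‖ ^ 2)
    have h3 : (‖z‖ ^ 2)⁻¹ * ‖z‖ = ‖z‖⁻¹ := by field_simp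
    linarith

theorem diskReflection_eq_exp_arg (z : ℂ) :
    diskReflection z = ‖diskReflection z‖ * Complex.exp (z.arg * Complex.I) := by
  rw [norm_diskReflection, Complex.ofReal_mul, mul_assoc, Complex.norm_mul_exp_arg_mul_I,
    diskReflection]

/-- Reflecting both points into the disk turns the Euclidean distance into the Green kernel of the
disk, up to the factors `max 1 |x|` and `max 1 |y|`. -/
theorem norm_sub_le_mul_norm_one_sub (x y : ℂ) :
    ‖x - y‖ ≤ max 1 ‖x‖ * max 1 ‖y‖ *
      ‖1 - diskReflection x * (starRingEnd ℂ) (diskReflection y)‖ := by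
  have hA : 0 < max 1 ‖x‖ := by positivity
  have hB : 0 < max 1 ‖y‖ := by positivity
  set A := max 1 ‖x‖ with hAdef
  set B := max 1 ‖y‖ with hBdef
  have e : 1 - diskReflection x * (starRingEnd ℂ) (diskReflection y) =
      1 - (((A * B) ^ 2)⁻¹ : ℝ) * (x * (starRingEnd ℂ) y) := by
    rw [diskReflection, diskReflection, map_mul, Complex.conj_ofReal, ← hAdef, ← hBdef, mul_pow,
      mul_inv]
    push_cast
    ring
  have hexp : ∀ c : ℝ, ‖1 - c * (x * (starRingEnd ℂ) y)‖ ^ 2 =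
      1 - 2 * c * (x * (starRingEnd ℂ) y).re + c ^ 2 * (‖x‖ ^ 2 * ‖y‖ ^ 2) := fun c => by
    simp only [Complex.sq_norm, Complex.normSq_apply, Complex.sub_re, Complex.sub_im,
      Complex.one_re, Complex.one_im, Complex.ofReal_re, Complex.ofReal_im, Complex.mul_re,
      Complex.mul_im, Complex.conj_re, Complex.conj_im]
    ring
  have hsub : ‖x - y‖ ^ 2 = ‖x‖ ^ 2 + ‖y‖ ^ 2 - 2 * (x * (starRingEnd ℂ) y).re := by
    simp only [Complex.sq_norm, Complex.normSq_sub]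
  have hAB : ((A * B) ^ 2) * ((A * B) ^ 2)⁻¹ = 1 := mul_inv_cancel₀ (by positivity)
  set c := ((A * B) ^ 2)⁻¹ with hc
  have key : ‖x‖ ^ 2 + ‖y‖ ^ 2 ≤ (A * B) ^ 2 + c * (‖x‖ ^ 2 * ‖y‖ ^ 2) := by
    rcases le_total ‖x‖ 1 with hx | hx <;> rcases le_total ‖y‖ 1 with hy | hy
    · have hx2 : ‖x‖ ^ 2 ≤ 1 := pow_le_one₀ (norm_nonneg x) hx
      have hy2 : ‖y‖ ^ 2 ≤ 1 := pow_le_one₀ (norm_nonneg y) hy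
      rw [hc, hAdef, hBdef, max_eq_left hx, max_eq_left hy]
      norm_num
      nlinarith
    · have : ‖y‖ ≠ 0 := by positivity
      rw [hc, hAdef, hBdef, max_eq_left hx, max_eq_right hy]
      field_simp
      linarith
    · have : ‖x‖ ≠ 0 := by positivity
      rw [hc, hAdef, hBdef, max_eq_right hx, max_eq_left hy]
      field_simp
      linarith
    · have h1 : ‖x‖ ≠ 0 := by positivity
      have h2 : ‖y‖ ≠ 0 := by positivity
      have hx2 : 1 ≤ ‖x‖ ^ 2 := one_le_pow₀ hx
      have hy2 : 1 ≤ ‖y‖ ^ 2 := one_le_pow₀ hy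
      rw [hc, hAdef, hBdef, max_eq_right hx, max_eq_right hy, ← mul_pow,
        inv_mul_cancel₀ (by positivity)]
      nlinarith
  refine le_of_sq_le_sq ?_ (by positivity)
  rw [e, mul_pow, hexp, hsub]
  calc _ ≤ (A * B) ^ 2 - 2 * (x * (starRingEnd ℂ) y).re + c * (‖x‖ ^ 2 * ‖y‖ ^ 2) := by linarith
    _ = _ := by linear_combination (2 * (x * (starRingEnd ℂ) y).re -
        c * (‖x‖ ^ 2 * ‖y‖ ^ 2)) * hAB

/-- The value `|1 - w|` is controlled by `|1 - r w|` in the closed unit disk, with a constant that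
tends to `1` as `r → 1`. -/
theorem log_norm_one_sub_le {r : ℝ} (h0 : 0 < r) (h1 : r < 1) {w : ℂ} (hw : ‖w‖ ≤ 1) (hw1 : w ≠ 1) :
    Real.log ‖1 - w‖ ≤ Real.log ‖1 - r * w‖ - Real.log r / 2 := by
  have key : r * ‖1 - w‖ ^ 2 ≤ ‖1 - r * w‖ ^ 2 := by
    have hw2 : ‖w‖ ^ 2 ≤ 1 := by nlinarith [norm_nonneg w]
    rw [Complex.sq_norm, Complex.normSq_apply] at hw2 ⊢
    rw [Complex.sq_norm, Complex.normSq_apply]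
    simp only [Complex.sub_re, Complex.sub_im, Complex.one_re, Complex.one_im, Complex.re_ofReal_mul,
      Complex.im_ofReal_mul]
    nlinarith [mul_nonneg (sub_nonneg.2 h1.le)
      (show 0 ≤ 1 - r * (w.re * w.re + w.im * w.im) by nlinarith)]
  have hpos : 0 < ‖1 - w‖ := norm_pos_iff.2 (sub_ne_zero.2 hw1.symm)
  have hl := Real.log_le_log (by positivity) key
  rw [Real.log_mul h0.ne' (by positivity), Real.log_pow, Real.log_pow] at hl
  push_cast at hl
  linarith

/-- Positivity of the logarithmic energy on the disk: the `k`-th term of the expansion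
`-log |1 - w| = Re ∑ w ^ k / k` bounds the energy from below. -/
theorem normSq_sum_pow_le_energy (S : Finset ℂ) (a : ℂ → ℂ) (ha : ∀ x ∈ S, ‖a x‖ ≤ 1)
    {r : ℝ} (h0 : 0 < r) (h1 : r < 1) (k : ℕ) :
    r ^ k / k * ‖∑ x ∈ S, a x ^ k‖ ^ 2 ≤
      ∑ x ∈ S, ∑ y ∈ S, -Real.log ‖1 - r * (a x * (starRingEnd ℂ) (a y))‖ := by
  have hterm : ∀ x ∈ S, ∀ y ∈ S, HasSum
      (fun j : ℕ => ((r * (a x * (starRingEnd ℂ) (a y))) ^ j / j : ℂ))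
      (-Complex.log (1 - r * (a x * (starRingEnd ℂ) (a y)))) := fun x hx y hy => by
    refine Complex.hasSum_taylorSeries_neg_log ?_
    rw [norm_mul, norm_mul, RCLike.norm_conj, Complex.norm_real, Real.norm_of_nonneg h0.le]
    have := mul_le_one₀ (ha x hx) (norm_nonneg _) (ha y hy)
    nlinarith
  have hsum := Complex.hasSum_re (hasSum_sum fun x hx => hasSum_sum fun y hy => hterm x hx y hy)
  have hval : ∀ j : ℕ, (∑ x ∈ S, ∑ y ∈ S, ((r * (a x * (starRingEnd ℂ) (a y))) ^ j / j : ℂ)).re =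
      r ^ j / j * ‖∑ x ∈ S, a x ^ j‖ ^ 2 := by
    intro j
    have : (∑ x ∈ S, ∑ y ∈ S, ((r * (a x * (starRingEnd ℂ) (a y))) ^ j / j : ℂ)) =
        ((r ^ j / j * ‖∑ x ∈ S, a x ^ j‖ ^ 2 : ℝ) : ℂ) := by
      push_cast
      rw [← Complex.mul_conj', map_sum, Finset.sum_mul_sum, Finset.mul_sum]
      refine Finset.sum_congr rfl fun x _ => ?_
      rw [Finset.mul_sum]
      refine Finset.sum_congr rfl fun y _ => ?_
      rw [map_pow]
      ring
    rw [this, Complex.ofReal_re]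
  simp only [hval] at hsum
  have hle := le_hasSum hsum k fun j _ => by positivity
  refine hle.trans (le_of_eq ?_)
  simp [Complex.re_sum, Complex.log_re]

/-- The energy bound for the reflected zeros of an integer polynomial with simple zeros: their power
sums are controlled by the Mahler measure. -/
theorem normSq_sum_diskReflection_pow_le {P : ℤ[X]} (hdeg : 1 ≤ P.natDegree)
    (hs : (P.map (Int.castRingHom ℂ)).roots.Nodup) {S : Finset ℂ}
    (hS : S = (P.map (Int.castRingHom ℂ)).roots.toFinset) (hcard : S.card = P.natDegree)
    {l : ℝ} (hl : l = Real.log ‖(P.map (Int.castRingHom ℂ)).leadingCoeff‖)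
    {r : ℝ} (h0 : 0 < r) (h1 : r < 1) (k : ℕ) :
    r ^ k / k * ‖∑ x ∈ S, diskReflection x ^ k‖ ^ 2 ≤
      2 * P.natDegree * (l + ∑ x ∈ S, Real.posLog ‖x‖) +
        (P.natDegree : ℝ) ^ 2 / 2 * -Real.log r + P.natDegree * -Real.log (1 - r) := by
  have hl0 : 0 ≤ l := by
    rw [hl, leadingCoeff_map_of_injective (RingHom.injective_int _), eq_intCast]
    exact zero_le_log_norm_intCast _
  have hdisc := zero_le_log_leadingCoeff_add_sum_log_sub hdeg hs
  rw [← hS, ← hl] at hdisc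
  have henergy := normSq_sum_pow_le_energy S diskReflection
    (fun x _ => norm_diskReflection_le_one x) h0 h1 k
  set n : ℝ := (P.natDegree : ℝ) with hn
  set K : ℂ → ℂ → ℝ := fun x y => Real.posLog ‖x‖ + Real.posLog ‖y‖ +
    (Real.log ‖1 - r * (diskReflection x * (starRingEnd ℂ) (diskReflection y))‖ -
      Real.log r / 2) with hK
  have hlogr : Real.log r < 0 := Real.log_neg h0 h1
  have hpair : ∀ x y : ℂ, x ≠ y → Real.log ‖x - y‖ ≤ K x y := by
    intro x y hxy
    have hb := norm_sub_le_mul_norm_one_sub x y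
    have hpos : 0 < ‖x - y‖ := norm_pos_iff.2 (sub_ne_zero.2 hxy)
    set w := diskReflection x * (starRingEnd ℂ) (diskReflection y) with hw
    have hw1 : w ≠ 1 := fun h => by
      rw [h, sub_self, norm_zero, mul_zero] at hb
      linarith
    have hwle : ‖w‖ ≤ 1 := by
      rw [hw, norm_mul, RCLike.norm_conj]
      exact mul_le_one₀ (norm_diskReflection_le_one x) (norm_nonneg _)
        (norm_diskReflection_le_one y)
    have h3 : ‖1 - w‖ ≠ 0 := norm_ne_zero_iff.2 (sub_ne_zero.2 hw1.symm)
    have h4 := Real.log_le_log hpos hb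
    rw [Real.log_mul (by positivity) h3, Real.log_mul (by positivity) (by positivity),
      ← Real.posLog_eq_log_max_one (norm_nonneg x), ← Real.posLog_eq_log_max_one (norm_nonneg y)]
      at h4
    have h5 := log_norm_one_sub_le h0 h1 hwle hw1
    simp only [hK]
    linarith
  have hdiag : ∀ x : ℂ, Real.log (1 - r) ≤ K x x := by
    intro x
    have hx := norm_diskReflection_le_one x
    have hx2 : ‖diskReflection x‖ ^ 2 ≤ 1 := pow_le_one₀ (norm_nonneg _) hx
    have e : (1 : ℂ) - r * (diskReflection x * (starRingEnd ℂ) (diskReflection x)) =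
        ((1 - r * ‖diskReflection x‖ ^ 2 : ℝ) : ℂ) := by
      rw [Complex.mul_conj']
      push_cast
      ring
    have hge : 1 - r ≤ 1 - r * ‖diskReflection x‖ ^ 2 := by nlinarith
    have hlog := Real.log_le_log (by linarith) hge
    simp only [hK]
    rw [e, Complex.norm_real, Real.norm_of_nonneg (by linarith)]
    have := Real.posLog_nonneg (x := ‖x‖)
    linarith
  have hoff : ∑ x ∈ S, ∑ y ∈ S.erase x, Real.log ‖x - y‖ ≤
      ∑ x ∈ S, ∑ y ∈ S, K x y - n * Real.log (1 - r) := by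
    have : ∀ x ∈ S, ∑ y ∈ S.erase x, Real.log ‖x - y‖ ≤ ∑ y ∈ S, K x y - Real.log (1 - r) := by
      intro x hx
      rw [← Finset.add_sum_erase S (K x) hx]
      have := Finset.sum_le_sum fun y (hy : y ∈ S.erase x) =>
        hpair x y (Finset.ne_of_mem_erase hy).symm
      linarith [hdiag x]
    refine (Finset.sum_le_sum this).trans (le_of_eq ?_)
    rw [Finset.sum_sub_distrib, Finset.sum_const, hcard, nsmul_eq_mul]
  have hKsum : ∑ x ∈ S, ∑ y ∈ S, K x y = 2 * n * ∑ x ∈ S, Real.posLog ‖x‖ -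
      ∑ x ∈ S, ∑ y ∈ S,
        -Real.log ‖1 - r * (diskReflection x * (starRingEnd ℂ) (diskReflection y))‖ -
      n ^ 2 * (Real.log r / 2) := by
    simp only [hK, Finset.sum_add_distrib, Finset.sum_sub_distrib, Finset.sum_const, hcard,
      nsmul_eq_mul, Finset.sum_neg_distrib, ← hn, ← Finset.mul_sum]
    ring
  linarith

/-- Zeros inside the disk are penalised: the excess of `log 1/|z|` over `(1 - |z|²) / 2` is at least
`(1 - |z|²)² / 4`. At `z = 0`, where `log 0 = 0`, the constant `3 / 4` makes up for it. -/
theorem sq_le_posLog_sub_log (z : ℂ) :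
    (max 0 (1 - ‖z‖ ^ 2)) ^ 2 / 4 ≤ Real.posLog ‖z‖ - max 0 (1 - ‖z‖ ^ 2) / 2 -
      Real.log ‖z‖ + if z = 0 then 3 / 4 else 0 := by
  rcases eq_or_ne z 0 with rfl | hz
  · norm_num
  rw [if_neg hz, add_zero]
  have h0 : 0 < ‖z‖ := norm_pos_iff.2 hz
  rcases le_or_gt 1 ‖z‖ with h | h
  · rw [max_eq_left (by nlinarith), Real.posLog_eq_log (by rwa [abs_of_pos h0])]
    norm_num
  · rw [max_eq_right (by nlinarith),
      (Real.posLog_eq_zero_iff _).2 (by rw [abs_of_pos h0]; exact h.le)]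
    -- with `s = |z|²`, this is `log s ≤ -(1 - s) - (1 - s)² / 2`
    set s := ‖z‖ ^ 2 with hs
    have hs0 : 0 < s := by positivity
    have hs1 : s < 1 := by nlinarith
    have hsum := Real.hasSum_pow_div_log_of_abs_lt_one (x := 1 - s)
      (by rw [abs_of_pos (by linarith)]; linarith)
    have hle := sum_le_hasSum (Finset.range 2) (fun j _ => by
      have : 0 < 1 - s := by linarith
      positivity) hsum
    rw [sub_sub_cancel, hs, Real.log_pow, ← hs] at hle
    norm_num [Finset.sum_range_succ] at hle
    linarith

/-- The zeros of an integer polynomial accumulate inside the disk only near the circle, at a rate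
governed by its areal Mahler measure. -/
theorem sum_sq_le_log_arealMahler {P : ℤ[X]} (hP : P ≠ 0)
    (hs : (P.map (Int.castRingHom ℂ)).roots.Nodup) {S : Finset ℂ}
    (hS : S = (P.map (Int.castRingHom ℂ)).roots.toFinset) :
    ∑ z ∈ S, (max 0 (1 - ‖z‖ ^ 2)) ^ 2 ≤
      4 * Real.log (arealMahler (P.map (Int.castRingHom ℂ))) + 3 := by
  have hSval : S.val = (P.map (Int.castRingHom ℂ)).roots := by
    rw [hS, Multiset.toFinset_val, hs.dedup]
  have hp0 : P.map (Int.castRingHom ℂ) ≠ 0 :=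
    (Polynomial.map_ne_zero_iff (RingHom.injective_int _)).2 hP
  have hB := zero_le_log_leadingCoeff_add_sum_log_roots hP
  have hL := log_arealMahler hp0
  rw [← hSval] at hB hL
  change 0 ≤ _ + ∑ z ∈ S, Real.log ‖z‖ at hB
  change _ = _ + ∑ z ∈ S, (Real.posLog ‖z‖ - max 0 (1 - ‖z‖ ^ 2) / 2) at hL
  have hsum := Finset.sum_le_sum fun z (_ : z ∈ S) => sq_le_posLog_sub_log z
  rw [Finset.sum_add_distrib, Finset.sum_sub_distrib, ← Finset.sum_div, Finset.sum_ite_eq'] at hsum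
  have : (if (0 : ℂ) ∈ S then (3 / 4 : ℝ) else 0) ≤ 3 / 4 := by split_ifs <;> norm_num
  linarith

/-! ### Equidistribution from power moments -/

/-- The direction `z / |z|` is close to the reflection of `z` when the latter is close to the unit
circle. -/
theorem norm_exp_arg_pow_sub_diskReflection_pow_le (z : ℂ) (k : ℕ) :
    ‖Complex.exp (z.arg * Complex.I) ^ k - diskReflection z ^ k‖ ≤
      k * (1 - ‖diskReflection z‖) := by
  set t := ‖diskReflection z‖ with ht
  have ht0 : 0 ≤ t := norm_nonneg _
  have ht1 : t ≤ 1 := norm_diskReflection_le_one z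
  have e : Complex.exp (z.arg * Complex.I) ^ k - diskReflection z ^ k =
      ((1 - t ^ k : ℝ) : ℂ) * Complex.exp (z.arg * Complex.I) ^ k := by
    rw [diskReflection_eq_exp_arg z, ← ht]
    push_cast
    ring
  rw [e, norm_mul, norm_pow, Complex.norm_exp_ofReal_mul_I, one_pow, mul_one, Complex.norm_real,
    Real.norm_of_nonneg (sub_nonneg.2 (pow_le_one₀ ht0 ht1))]
  have := one_add_mul_le_pow (a := t - 1) (by linarith) k
  rw [add_sub_cancel] at this
  linarith

/-- A bounded continuous function changes little when a point is moved radially to the unit circle,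
up to a multiple of the distance of its reflection from the circle. -/
theorem exists_abs_sub_le_add_mul (f : BoundedContinuousFunction ℂ ℝ) {ε : ℝ} (hε : 0 < ε) :
    ∃ C : ℝ, ∀ z : ℂ, |f z - f (Complex.exp (z.arg * Complex.I))| ≤
      ε + C * (1 - ‖diskReflection z‖) := by
  have huc := (isCompact_closedBall (0 : ℂ) 2).uniformContinuousOn_of_continuous
    f.continuous.continuousOn
  obtain ⟨δ, hδ, hf⟩ := Metric.uniformContinuousOn_iff.1 huc ε hε
  set d := min δ 1 with hd
  have hd0 : 0 < d := lt_min hδ one_pos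
  have hd1 : d ≤ 1 := min_le_right _ _
  have hC : 0 ≤ 4 * ‖f‖ / d := by positivity
  refine ⟨4 * ‖f‖ / d, fun z => ?_⟩
  have ha := norm_diskReflection_le_one z
  rcases lt_or_ge |‖z‖ - 1| d with h | h
  · have hdist : dist z (Complex.exp (z.arg * Complex.I)) < δ := by
      have e : z - Complex.exp (z.arg * Complex.I) =
          ((‖z‖ - 1 : ℝ) : ℂ) * Complex.exp (z.arg * Complex.I) := by
        push_cast
        linear_combination -Complex.norm_mul_exp_arg_mul_I z
      rw [dist_eq_norm, e, norm_mul, Complex.norm_exp_ofReal_mul_I, mul_one, Complex.norm_real]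
      exact h.trans_le (min_le_left _ _)
    have hz : z ∈ Metric.closedBall (0 : ℂ) 2 := by
      rw [mem_closedBall_zero_iff]
      linarith [(abs_lt.1 h).2]
    have hw : Complex.exp (z.arg * Complex.I) ∈ Metric.closedBall (0 : ℂ) 2 := by
      rw [mem_closedBall_zero_iff, Complex.norm_exp_ofReal_mul_I]
      norm_num
    have := (hf z hz _ hw hdist).le
    rw [Real.dist_eq] at this
    have h2 : 0 ≤ 4 * ‖f‖ / d * (1 - ‖diskReflection z‖) := mul_nonneg hC (by linarith)
    linarith
  · have hfar : d / 2 ≤ 1 - ‖diskReflection z‖ := by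
      rw [norm_diskReflection]
      rcases le_total ‖z‖ 1 with hz | hz
      · rw [abs_of_nonpos (by linarith)] at h
        rw [max_eq_left hz]
        linarith
      · rw [abs_of_nonneg (by linarith)] at h
        rw [max_eq_right hz]
        have hz0 : 0 < ‖z‖ := by linarith
        have e : (‖z‖ ^ 2)⁻¹ * ‖z‖ = ‖z‖⁻¹ := by field_simp
        have h3 : ‖z‖⁻¹ ≤ (1 + d)⁻¹ := inv_anti₀ (by linarith) (by linarith)
        have h4 : (1 + d)⁻¹ ≤ 1 - d / 2 := by
          rw [inv_le_iff_one_le_mul₀ (by linarith)]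
          nlinarith
        linarith
    have hb : |f z - f (Complex.exp (z.arg * Complex.I))| ≤ 2 * ‖f‖ := by
      have h1 := f.norm_coe_le_norm z
      have h2 := f.norm_coe_le_norm (Complex.exp (z.arg * Complex.I))
      have h3 := norm_sub_le (f z) (f (Complex.exp (z.arg * Complex.I)))
      rw [← Real.norm_eq_abs]
      linarith
    have h5 : 4 * ‖f‖ / d * (d / 2) = 2 * ‖f‖ := by field_simp; ring
    have := mul_le_mul_of_nonneg_left hfar hC
    linarith

/-- Weyl's criterion for finite point sets in the plane whose reflections approach the unit
circle: vanishing power moments imply equidistribution of the directions. -/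
theorem tendsto_average_arg {S : ℕ → Finset ℂ} (hcard : ∀ n, 1 ≤ n → (S n).card = n)
    (hnear : Tendsto (fun n : ℕ => (∑ z ∈ S n, (1 - ‖diskReflection z‖)) / n) atTop (𝓝 0))
    (hmom : ∀ k : ℕ, 1 ≤ k →
      Tendsto (fun n : ℕ => (∑ z ∈ S n, diskReflection z ^ k) / (n : ℂ)) atTop (𝓝 0))
    [Fact (0 < 2 * Real.pi)] (g : C(AddCircle (2 * Real.pi), ℂ)) :
    Tendsto (fun n : ℕ => (∑ z ∈ S n, g (z.arg : ℝ)) / (n : ℂ)) atTop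
      (𝓝 (∫ x, g x ∂AddCircle.haarAddCircle)) := by
  have hexp : ∀ k : ℕ, ∀ z : ℂ, fourier (T := 2 * Real.pi) (k : ℤ) ((z.arg : ℝ) : AddCircle _) =
      Complex.exp (z.arg * Complex.I) ^ k := fun k z => by
    rw [fourier_coe_apply, ← Complex.exp_nat_mul]
    congr 1
    have : (Real.pi : ℂ) ≠ 0 := Complex.ofReal_ne_zero.2 Real.pi_pos.ne'
    push_cast
    field_simp
  have hpos : ∀ k : ℕ, 1 ≤ k → Tendsto (fun n : ℕ => (∑ z ∈ S n,
      fourier (T := 2 * Real.pi) (k : ℤ) ((z.arg : ℝ) : AddCircle _)) / (n : ℂ)) atTop (𝓝 0) := by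
    intro k hk
    have hdiff : Tendsto (fun n : ℕ => (∑ z ∈ S n, (fourier (T := 2 * Real.pi) (k : ℤ)
        ((z.arg : ℝ) : AddCircle _) - diskReflection z ^ k)) / (n : ℂ)) atTop (𝓝 0) := by
      refine squeeze_zero_norm (fun n => ?_) (by simpa only [mul_zero] using hnear.const_mul (k : ℝ))
      rw [norm_div, Complex.norm_natCast, ← mul_div_assoc, Finset.mul_sum]
      gcongr
      refine norm_sum_le_of_le _ fun z _ => ?_
      rw [hexp]
      exact norm_exp_arg_pow_sub_diskReflection_pow_le z k
    simpa [Finset.sum_sub_distrib, sub_div] using hdiff.add (hmom k hk)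
  have hfour : ∀ j : ℤ, Tendsto (fun n : ℕ => (∑ z ∈ S n,
      fourier (T := 2 * Real.pi) j ((z.arg : ℝ) : AddCircle _)) / (n : ℂ)) atTop
      (𝓝 (∫ x, fourier (T := 2 * Real.pi) j x ∂AddCircle.haarAddCircle)) := by
    intro j
    have hint : ∫ x, fourier (T := 2 * Real.pi) j x ∂AddCircle.haarAddCircle =
        if j = 0 then 1 else 0 := by
      split_ifs with hj
      · simp [hj]
      · exact integral_eq_zero_of_add_right_eq_neg
          (fourier_add_half_inv_index hj Real.two_pi_pos)
    rw [hint]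
    obtain ⟨k, rfl | rfl⟩ := Int.eq_nat_or_neg j
    · rcases Nat.eq_zero_or_pos k with rfl | hk
      · rw [if_pos (by simp)]
        refine tendsto_const_nhds.congr' ?_
        filter_upwards [eventually_ge_atTop 1] with n hn
        have : (n : ℂ) ≠ 0 := Nat.cast_ne_zero.2 (by omega)
        simp [hcard n hn, this]
      · rw [if_neg (by exact_mod_cast hk.ne')]
        exact hpos k hk
    · rcases Nat.eq_zero_or_pos k with rfl | hk
      · rw [if_pos (by simp)]
        refine tendsto_const_nhds.congr' ?_
        filter_upwards [eventually_ge_atTop 1] with n hn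
        have : (n : ℂ) ≠ 0 := Nat.cast_ne_zero.2 (by omega)
        simp [hcard n hn, this]
      · rw [if_neg (by simpa using hk.ne')]
        have := (Complex.continuous_conj.tendsto 0).comp (hpos k hk)
        rw [map_zero] at this
        refine this.congr fun n => ?_
        simp only [Function.comp_apply, map_div₀, map_sum, Complex.conj_natCast, fourier_neg]
  have hspan : ∀ h ∈ Submodule.span ℂ (Set.range (fourier (T := 2 * Real.pi))),
      Tendsto (fun n : ℕ => (∑ z ∈ S n, h ((z.arg : ℝ) : AddCircle _)) / (n : ℂ)) atTop
        (𝓝 (∫ x, h x ∂AddCircle.haarAddCircle)) := by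
    intro h hh
    induction hh using Submodule.span_induction with
    | mem x hx => obtain ⟨j, rfl⟩ := hx; exact hfour j
    | zero => simp
    | add u v _ _ hu hv =>
      have hu' : Integrable u AddCircle.haarAddCircle :=
        u.continuous.integrable_of_hasCompactSupport (HasCompactSupport.of_compactSpace _)
      have hv' : Integrable v AddCircle.haarAddCircle :=
        v.continuous.integrable_of_hasCompactSupport (HasCompactSupport.of_compactSpace _)
      simp only [ContinuousMap.add_apply]
      rw [integral_add hu' hv']
      simpa [Finset.sum_add_distrib, add_div] using hu.add hv
    | smul c u _ hu =>
      simp only [ContinuousMap.smul_apply, smul_eq_mul, integral_const_mul, ← Finset.mul_sum,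
        mul_div_assoc]
      exact hu.const_mul c
  have hdense : g ∈ closure (Submodule.span ℂ (Set.range (fourier (T := 2 * Real.pi))) :
      Set C(AddCircle (2 * Real.pi), ℂ)) := by
    rw [← Submodule.topologicalClosure_coe, span_fourier_closure_eq_top]
    trivial
  refine Metric.tendsto_atTop.2 fun ε hε => ?_
  obtain ⟨h, hh, hgh⟩ := Metric.mem_closure_iff.1 hdense (ε / 3) (by positivity)
  obtain ⟨N, hN⟩ := Metric.tendsto_atTop.1 (hspan h hh) (ε / 3) (by positivity)
  have hb : ∀ x, ‖g x - h x‖ ≤ dist g h := fun x => by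
    rw [← dist_eq_norm]; exact ContinuousMap.dist_apply_le_dist x
  refine ⟨N + 1, fun n hn => ?_⟩
  have h2 := hN n (by omega)
  have hn0 : (0 : ℝ) < n := by exact_mod_cast (by omega : 0 < n)
  have h1 : dist ((∑ z ∈ S n, g ((z.arg : ℝ) : AddCircle _)) / (n : ℂ))
      ((∑ z ∈ S n, h ((z.arg : ℝ) : AddCircle _)) / (n : ℂ)) ≤ dist g h := by
    rw [dist_eq_norm, ← sub_div, ← Finset.sum_sub_distrib, norm_div, Complex.norm_natCast,
      div_le_iff₀ hn0]
    refine (norm_sum_le_of_le _ fun z _ => hb _).trans (le_of_eq ?_)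
    rw [Finset.sum_const, hcard n (by omega), nsmul_eq_mul, mul_comm]
  have h3 : dist (∫ x, h x ∂AddCircle.haarAddCircle) (∫ x, g x ∂AddCircle.haarAddCircle) ≤
      dist g h := by
    have hg' : Integrable g AddCircle.haarAddCircle :=
      g.continuous.integrable_of_hasCompactSupport (HasCompactSupport.of_compactSpace _)
    have hh' : Integrable h AddCircle.haarAddCircle :=
      h.continuous.integrable_of_hasCompactSupport (HasCompactSupport.of_compactSpace _)
    rw [dist_comm, dist_eq_norm, ← integral_sub hg' hh']
    simpa using norm_integral_le_of_norm_le_const (μ := AddCircle.haarAddCircle)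
      (Eventually.of_forall hb)
  have := dist_triangle4 ((∑ z ∈ S n, g ((z.arg : ℝ) : AddCircle _)) / (n : ℂ))
    ((∑ z ∈ S n, h ((z.arg : ℝ) : AddCircle _)) / (n : ℂ))
    (∫ x, h x ∂AddCircle.haarAddCircle) (∫ x, g x ∂AddCircle.haarAddCircle)
  linarith

/-- Point sets whose reflections approach the unit circle and have vanishing power moments are
equidistributed along the circle. -/
theorem tendsto_average_circleAverage {S : ℕ → Finset ℂ} (hcard : ∀ n, 1 ≤ n → (S n).card = n)
    (hnear : Tendsto (fun n : ℕ => (∑ z ∈ S n, (1 - ‖diskReflection z‖)) / n) atTop (𝓝 0))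
    (hmom : ∀ k : ℕ, 1 ≤ k →
      Tendsto (fun n : ℕ => (∑ z ∈ S n, diskReflection z ^ k) / (n : ℂ)) atTop (𝓝 0))
    (f : BoundedContinuousFunction ℂ ℝ) :
    Tendsto (fun n : ℕ => (∑ z ∈ S n, f z) / n) atTop (𝓝 (Real.circleAverage f 0 1)) := by
  have : Fact (0 < 2 * Real.pi) := ⟨by positivity⟩
  set g : C(AddCircle (2 * Real.pi), ℂ) :=
    ⟨fun x => (f (AddCircle.toCircle x : ℂ) : ℂ), by
      have := f.continuous
      have h2 : Continuous fun x : AddCircle (2 * Real.pi) => (AddCircle.toCircle x : ℂ) :=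
        continuous_subtype_val.comp AddCircle.continuous_toCircle
      exact Complex.continuous_ofReal.comp (this.comp h2)⟩ with hg
  have hgval : ∀ θ : ℝ, g (θ : AddCircle (2 * Real.pi)) =
      (f (Complex.exp (θ * Complex.I)) : ℂ) := fun θ => by
    have h2 : 2 * Real.pi / (2 * Real.pi) * θ = θ := by field_simp
    simp only [hg, ContinuousMap.coe_mk, AddCircle.toCircle_apply_mk, h2, Circle.coe_exp]
  have hint : ∫ x, g x ∂AddCircle.haarAddCircle = ((Real.circleAverage f 0 1 : ℝ) : ℂ) := by
    rw [AddCircle.integral_haarAddCircle, ← AddCircle.intervalIntegral_preimage (2 * Real.pi) 0,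
      Real.circleAverage]
    simp only [hgval, zero_add, intervalIntegral.integral_ofReal, circleMap]
    simp
  have hg' := tendsto_average_arg hcard hnear hmom g
  rw [hint] at hg'
  have hre : Tendsto (fun n : ℕ => (∑ z ∈ S n, f (Complex.exp (z.arg * Complex.I))) / n) atTop
      (𝓝 (Real.circleAverage f 0 1)) := by
    have := (Complex.continuous_re.tendsto _).comp hg'
    rw [Complex.ofReal_re] at this
    refine this.congr fun n => ?_
    simp only [Function.comp_apply, hgval]
    rw [← Complex.ofReal_sum, ← Complex.ofReal_natCast, ← Complex.ofReal_div, Complex.ofReal_re]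
  have hdiff : Tendsto (fun n : ℕ => (∑ z ∈ S n, (f z - f (Complex.exp (z.arg * Complex.I)))) / n)
      atTop (𝓝 0) := by
    refine Metric.tendsto_atTop.2 fun ε hε => ?_
    obtain ⟨C, hC⟩ := exists_abs_sub_le_add_mul f (half_pos hε)
    have hC0 := hnear.const_mul C
    rw [mul_zero] at hC0
    obtain ⟨N, hN⟩ := eventually_atTop.1 (hC0.eventually_lt_const (half_pos hε))
    refine ⟨N + 1, fun n hn => ?_⟩
    have hn0 : (0 : ℝ) < n := by exact_mod_cast (by omega : 0 < n)
    have h1 := hN n (by omega)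
    rw [dist_zero_right, norm_div, Real.norm_natCast]
    have h2 : ‖∑ z ∈ S n, (f z - f (Complex.exp (z.arg * Complex.I)))‖ ≤
        n * (ε / 2) + C * ∑ z ∈ S n, (1 - ‖diskReflection z‖) := by
      refine (norm_sum_le_of_le _ fun z _ => hC z).trans (le_of_eq ?_)
      rw [Finset.sum_add_distrib, Finset.sum_const, hcard n (by omega), nsmul_eq_mul,
        Finset.mul_sum]
    calc _ ≤ (n * (ε / 2) + C * ∑ z ∈ S n, (1 - ‖diskReflection z‖)) / n := by gcongr
      _ = ε / 2 + C * ((∑ z ∈ S n, (1 - ‖diskReflection z‖)) / n) := by field_simp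
      _ < ε := by linarith
  simpa [Finset.sum_sub_distrib, sub_div] using hdiff.add hre

/-! ### Weak convergence of the zero counting measures -/

theorem integral_zeroCountingMeasure {p : ℂ[X]} (hs : p.roots.Nodup)
    (f : BoundedContinuousFunction ℂ ℝ) :
    ∫ z, f z ∂zeroCountingMeasure p = (∑ z ∈ p.roots.toFinset, f z) / p.natDegree := by
  have hval : p.roots = p.roots.toFinset.val := by rw [Multiset.toFinset_val, hs.dedup]
  have hsum : (p.roots.map fun z => (Measure.dirac z : Measure ℂ)).sum =
      ∑ z ∈ p.roots.toFinset, Measure.dirac z := by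
    conv_lhs => rw [hval]
    rfl
  rw [zeroCountingMeasure, hsum, integral_smul_nnreal_measure,
    integral_finsetSum_measure fun z _ => f.integrable _]
  simp only [integral_dirac, NNReal.smul_def, smul_eq_mul]
  push_cast
  ring

theorem integral_normalizedArclength (f : BoundedContinuousFunction ℂ ℝ) :
    ∫ z, f z ∂normalizedArclength = Real.circleAverage f 0 1 := by
  rw [normalizedArclength, integral_map (by fun_prop) f.continuous.aestronglyMeasurable,
    integral_smul_measure, Real.circleAverage, intervalIntegral.integral_of_le (by positivity),
    ENNReal.toReal_inv, ENNReal.toReal_ofReal (by positivity)]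
  simp [circleMap]

/-- If for every `r < 1` a nonnegative sequence satisfies the energy bound with vanishing error
terms, letting `r → 1` shows that it tends to zero. -/
theorem tendsto_zero_of_energy_bound {x e : ℕ → ℝ} (hx : ∀ n, 0 ≤ x n)
    (he : Tendsto e atTop (𝓝 0)) {k : ℕ} (hk : 1 ≤ k)
    (h : ∀ r : ℝ, 0 < r → r < 1 → ∀ n : ℕ, 1 ≤ n →
      r ^ k / k * x n ≤ e n + -Real.log r / 2 + -Real.log (1 - r) / n) :
    Tendsto x atTop (𝓝 0) := by
  have hk0 : (0 : ℝ) < k := by exact_mod_cast hk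
  refine Metric.tendsto_atTop.2 fun ε hε => ?_
  have hr : ∀ᶠ r : ℝ in 𝓝[<] 1, -Real.log r / 2 < r ^ k / k * ε := by
    have h1 : ContinuousAt (fun r : ℝ => r ^ k / k * ε - -Real.log r / 2) 1 := by
      have := Real.continuousAt_log (x := 1) one_ne_zero
      fun_prop
    have h2 := h1.eventually_const_lt (u := 0) (by simp; positivity)
    filter_upwards [h2.filter_mono nhdsWithin_le_nhds] with r hr
    linarith
  have h01 : ∀ᶠ r : ℝ in 𝓝[<] 1, r ∈ Set.Ioo (0 : ℝ) 1 := Ioo_mem_nhdsLT one_pos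
  obtain ⟨r, hr, hr0, hr1⟩ := (hr.and h01).exists
  have hlim : Tendsto (fun n : ℕ => e n + -Real.log r / 2 + -Real.log (1 - r) / n) atTop
      (𝓝 (0 + -Real.log r / 2 + 0)) :=
    (he.add_const _).add (tendsto_const_div_atTop_nhds_zero_nat _)
  rw [zero_add, add_zero] at hlim
  obtain ⟨N, hN⟩ := eventually_atTop.1 (hlim.eventually_lt_const hr)
  refine ⟨N + 1, fun n hn => ?_⟩
  rw [dist_zero_right, Real.norm_of_nonneg (hx n)]
  exact lt_of_mul_lt_mul_left ((h r hr0 hr1 n (by omega)).trans_lt (hN n (by omega)))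
    (by positivity)

theorem theorem2p1 (P : ℕ → ℤ[X])
    (hdeg : ∀ n : ℕ, 1 ≤ n → (P n).natDegree = n)
    (hsimple : ∀ n : ℕ, 1 ≤ n → ((P n).map (Int.castRingHom ℂ)).roots.Nodup)
    (hlim : Tendsto
      (fun n : ℕ => arealMahler ((P n).map (Int.castRingHom ℂ)) ^ (1 / (n : ℝ)))
      atTop (𝓝 1)) :
    Tendsto (fun n : ℕ => zeroCountingFiniteMeasure ((P n).map (Int.castRingHom ℂ)))
      atTop (𝓝 arclengthFiniteMeasure) := by
  have hinj : Function.Injective (Int.castRingHom ℂ) := RingHom.injective_int _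
  set p : ℕ → ℂ[X] := fun n => (P n).map (Int.castRingHom ℂ) with hp
  set S : ℕ → Finset ℂ := fun n => (p n).roots.toFinset with hS
  have hP0 : ∀ n, 1 ≤ n → P n ≠ 0 := fun n hn =>
    ne_zero_of_natDegree_gt (n := 0) (by rw [hdeg n hn]; omega)
  have hpdeg : ∀ n, 1 ≤ n → (p n).natDegree = n := fun n hn => by
    rw [hp, natDegree_map_eq_of_injective hinj, hdeg n hn]
  have hSval : ∀ n, 1 ≤ n → (p n).roots = (S n).val := fun n hn => by
    rw [hS, Multiset.toFinset_val, (hsimple n hn).dedup]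
  have hcard : ∀ n, 1 ≤ n → (S n).card = n := fun n hn => by
    have h := (IsAlgClosed.splits (p n)).natDegree_eq_card_roots
    rwa [hpdeg n hn, hSval n hn, Finset.card_val, eq_comm] at h
  -- the normalized logarithms of the areal Mahler measures
  have hL : Tendsto (fun n : ℕ => Real.log (arealMahler (p n)) / n) atTop (𝓝 0) := by
    have := (Real.continuousAt_log one_ne_zero).tendsto.comp hlim
    rw [Real.log_one] at this
    refine this.congr fun n => ?_
    rw [Function.comp_apply, Real.log_rpow (by unfold arealMahler; positivity)]
    ring
  set U : ℕ → ℝ := fun n => ∑ z ∈ S n, max 0 (1 - ‖z‖ ^ 2) with hU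
  set M : ℕ → ℝ := fun n => Real.log ‖(p n).leadingCoeff‖ + ∑ z ∈ S n, Real.posLog ‖z‖ with hM
  have hlogL : ∀ n, 1 ≤ n → Real.log (arealMahler (p n)) = M n - U n / 2 := fun n hn => by
    rw [log_arealMahler ((Polynomial.map_ne_zero_iff hinj).2 (hP0 n hn)), hSval n hn]
    change _ + ∑ z ∈ S n, (Real.posLog ‖z‖ - max 0 (1 - ‖z‖ ^ 2) / 2) = _
    rw [Finset.sum_sub_distrib, ← Finset.sum_div]
    simp only [hM, hU]
    ring
  -- the zeros inside the disk approach the circle, by the Cauchy-Schwarz inequality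
  have hU0 : Tendsto (fun n : ℕ => U n / n) atTop (𝓝 0) := by
    have hbound : Tendsto (fun n : ℕ => √(4 * (Real.log (arealMahler (p n)) / n) + 3 / n)) atTop
        (𝓝 0) := by
      have h1 := (hL.const_mul 4).add (tendsto_const_div_atTop_nhds_zero_nat (3 : ℝ))
      have := (Real.continuous_sqrt.tendsto _).comp h1
      rwa [mul_zero, add_zero, Real.sqrt_zero] at this
    refine squeeze_zero' (Eventually.of_forall fun n => ?_) ?_ hbound
    · exact div_nonneg (Finset.sum_nonneg fun _ _ => le_max_left _ _) n.cast_nonneg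
    · filter_upwards [eventually_ge_atTop 1] with n hn
      have hn0 : (0 : ℝ) < n := by exact_mod_cast hn
      refine Real.le_sqrt_of_sq_le ?_
      have h1 := sum_sq_le_log_arealMahler (hP0 n hn) (hsimple n hn) (S := S n) rfl
      have h2 := sq_sum_le_card_mul_sum_sq (s := S n) (f := fun z : ℂ => max 0 (1 - ‖z‖ ^ 2))
      rw [hcard n hn] at h2
      have h3 : U n ^ 2 ≤ n * (4 * Real.log (arealMahler (p n)) + 3) :=
        h2.trans (mul_le_mul_of_nonneg_left h1 hn0.le)
      calc (U n / n) ^ 2 = U n ^ 2 / n ^ 2 := div_pow _ _ _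
        _ ≤ n * (4 * Real.log (arealMahler (p n)) + 3) / n ^ 2 := by gcongr
        _ = _ := by field_simp
  have hM0 : Tendsto (fun n : ℕ => M n / n) atTop (𝓝 0) := by
    have := hL.add (hU0.div_const 2)
    rw [zero_div, add_zero] at this
    refine this.congr' ?_
    filter_upwards [eventually_ge_atTop 1] with n hn
    rw [hlogL n hn]
    ring
  have hnear : Tendsto (fun n : ℕ => (∑ z ∈ S n, (1 - ‖diskReflection z‖)) / n) atTop (𝓝 0) := by
    refine squeeze_zero (fun n => ?_) (fun n => ?_) (by simpa only [add_zero] using hU0.add hM0)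
    · exact div_nonneg (Finset.sum_nonneg fun z _ => sub_nonneg.2 (norm_diskReflection_le_one z))
        n.cast_nonneg
    · rw [← add_div]
      have h1 := Finset.sum_le_sum fun z (_ : z ∈ S n) => one_sub_norm_diskReflection_le z
      rw [Finset.sum_add_distrib] at h1
      have h2 : 0 ≤ Real.log ‖(p n).leadingCoeff‖ := by
        simp only [hp]
        rw [leadingCoeff_map_of_injective hinj, eq_intCast]
        exact zero_le_log_norm_intCast _
      gcongr
      simp only [hM]
      linarith
  have hmom : ∀ k : ℕ, 1 ≤ k →
      Tendsto (fun n : ℕ => (∑ z ∈ S n, diskReflection z ^ k) / (n : ℂ)) atTop (𝓝 0) := by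
    intro k hk
    have hsq : Tendsto (fun n : ℕ => ‖(∑ z ∈ S n, diskReflection z ^ k) / (n : ℂ)‖ ^ 2) atTop
        (𝓝 0) := by
      refine tendsto_zero_of_energy_bound (fun n => by positivity)
        (by simpa only [mul_zero] using hM0.const_mul 2) hk fun r hr0 hr1 n hn => ?_
      have hn0 : (0 : ℝ) < n := by exact_mod_cast hn
      have h1 := normSq_sum_diskReflection_pow_le (P := P n) (by rw [hdeg n hn]; exact hn)
        (hsimple n hn) (S := S n) rfl (by rw [hcard n hn, hdeg n hn]) rfl hr0 hr1 k
      rw [hdeg n hn] at h1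
      rw [norm_div, Complex.norm_natCast, div_pow, ← mul_div_assoc, div_le_iff₀ (by positivity)]
      refine h1.trans (le_of_eq ?_)
      change 2 * n * M n + _ + _ = _
      field_simp
    have := (Real.continuous_sqrt.tendsto _).comp hsq
    rw [Real.sqrt_zero] at this
    refine tendsto_zero_iff_norm_tendsto_zero.2 (this.congr fun n => ?_)
    exact Real.sqrt_sq (norm_nonneg _)
  refine FiniteMeasure.tendsto_iff_forall_integral_tendsto.2 fun f => ?_
  change Tendsto (fun n => ∫ z, f z ∂zeroCountingMeasure (p n)) atTop
    (𝓝 (∫ z, f z ∂normalizedArclength))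
  rw [integral_normalizedArclength]
  refine (tendsto_average_circleAverage hcard hnear hmom f).congr' ?_
  filter_upwards [eventually_ge_atTop 1] with n hn
  rw [integral_zeroCountingMeasure (hsimple n hn), hpdeg n hn]
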